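/- Let $M,N$ be positive integers. A configuration is a sequence $u=(u_p)_{p\ge 0}$ of letters in $\{1,\dots,M\}\cup\{e\}$ with $u_p=e$ for all but finitely many $p$; the letter $j\in\{1,\dots,M\}$ is a ball of colour $j$, $e$ is an empty box, and $e$ is regarded as greater than every colour. Let $\Omega$ be the set of configurations. For $u\in\Omega$ let $f(u)$ be the finite word obtained from $u$ by deleting all letters $e$. For a word $w$ let $\emptyset\leftarrow w$ be the semistandard tableau (P-symbol) obtained by Schensted row insertion of the letters of $w$ from left to right into the empty tableau. **Block coordinates.** A block of $u$ is a maximal run of consecutive boxes that all contain balls and whose colours are non-decreasing. Let $n$ be the number of blocks of $u$. For $0\le i\le n-1$ and $1\le j\le M$ let $Q_i^{(j)}\ge 0$ be the number of balls of colour $j$ in the $(i+1)$-st block; let $E_{-1}\ge0$ be the number of empty boxes in front of the first block, and for $0\le i\le n-2$ let $E_i\ge0$ be the number of empty boxes between the $(i+1)$-st and the $(i+2)$-nd block. Conversely, any non-negative integers $Q_i^{(j)}$ $(0\le i\le n-1)$, $E_i$ $(-1\le i\le n-2)$ determine a configuration: for $i=0,\dots,n-1$ in turn, write $E_{i-1}$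 empty boxes and then $Q_i^{(1)}$ balls of colour $1$, …, $Q_i^{(M)}$ balls of colour $M$; all further boxes are empty. **One colour.** Let $\epsilon_0,\dots,\epsilon_{n-1}\in\{0,1\}$. The one-colour step maps non-negative integers $(Q_i)_{0\le i\le n-1}$, $(E_i)_{-1\le i\le n-2}$ to $(Q'_i)$, $(E'_i)$, where, with the conventions $E_{n-1}=+\infty$, $Q_{-1}=D_{-1}=Q'_{-1}=0$ (the value of $\epsilon_{-1}$ is then irrelevant), $\mathcal E_i=+\infty$ if $\epsilon_i=0$ and $\mathcal E_i=0$ if $\epsilon_i=1$, for $i=0,\dots,n-1$: $$\begin{aligned} &D_i=Q_i+D_{i-1}-Q'_{i-1},\quad Q'_i=\min(D_i,E_i) &&\text{if }(\epsilon_{i-1},\epsilon_i)=(0,0),\\ &D_i=\min(Q_i,E_i),\quad Q'_i=D_i+Q_{i-1}-D_{i-1} &&\text{if }(\epsilon_{i-1},\epsilon_i)=(1,1),\\ &D_i=\min(Q_i,E_i),\quad Q'_i=D_i+D_{i-1}-Q'_{i-1} &&\text{if }(\epsilon_{i-1},\epsilon_i)=(0,1),\\ &D_i=Q_i+Q_{i-1}-D_{i-1},\quad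 Q'_i=\min(D_i,E_i) &&\text{if }(\epsilon_{i-1},\epsilon_i)=(1,0), \end{aligned}$$ $$E'_{-1}=E_{-1}+\min(Q_0,\mathcal E_0+E_0),\qquad E'_i=\min(Q_{i+1},\mathcal E_{i+1}+E_{i+1})-\min(Q'_i,\mathcal E_i+E'_{i-1})+E_i\quad(0\le i\le n-2).$$ All these values are again non-negative integers. **The hungry $\epsilon$-BBS.** Let $\epsilon=(\epsilon_0,\dots,\epsilon_{N-1})\in\{0,1\}^N$, and put $\epsilon_i=0$ for $i\ge N$. For $u\in\Omega$ with $n$ blocks, $T_\epsilon(u)\in\Omega$ is the configuration obtained as follows: take the block coordinates of $u$; for $j=1,2,\dots,M$ in this order, apply the one-colour step with $\epsilon_0,\dots,\epsilon_{n-1}$ to $(Q_i^{(j)})_i$ and the current $(E_i)_i$, and replace $(Q_i^{(j)})_i$ and $(E_i)_i$ by the result; finally form the configuration determined by the resulting numbers. (The main case is $n=N$.) **Proposition.** For every $u\in\Omega$ and every $\epsilon\in\{0,1\}^N$, the tableaux $\emptyset\leftarrow f(u)$ and $\emptyset\leftarrow f(T_\epsilon(u))$ coincide. That is, the P-symbol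 of the RSK correspondence is a conserved quantity of the hungry $\epsilon$-BBS. -/

import Mathlib

namespace HungryBBS

/-! ### Schensted insertion

A tableau is given by the list of its rows, from top to bottom, each row read from left to right. -/

/-- Insertion of the letter `x` into a row: the leftmost letter greater than `x` is replaced by `x`
and returned; if there is none, `x` is appended at the right end and nothing is returned. -/
def insertRow {α : Type*} [LinearOrder α] (x : α) : List α → List α × Option α
  | [] => ([x], none)
  | y :: r =>
    if x < y then (x :: r, some y)
    else (y :: (insertRow x r).1, (insertRow x r).2)

/-- Schensted insertion `T ← x` of a letter: a letter thrown out of a row is inserted into the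
next row, until some row (possibly a new one) is extended at its right end. -/
def insertLetter {α : Type*} [LinearOrder α] : List (List α) → α → List (List α)
  | [], x => [[x]]
  | r :: T, x =>
    match insertRow x r with
    | (r', none) => r' :: T
    | (r', some y) => r' :: insertLetter T y

/-- Schensted insertion `T ← w` of a word, letter by letter from left to right. -/
def insertWord {α : Type*} [LinearOrder α] (T : List (List α)) (w : List α) : List (List α) :=
  w.foldl insertLetter T

/-- The P-symbol `∅ ← w` of a word. -/
def pSymbol {α : Type*} [LinearOrder α] (w : List α) : List (List α) :=
  insertWord [] w

/-! ### Configurations -/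

/-- A configuration of balls of `M` colours in the boxes `0, 1, 2, …`. The element `j : Fin M`
stands for the colour `j + 1`; the letter `⊤` is the empty box `e`, which is thus greater than all
colours. All but finitely many boxes are empty. -/
structure Config (M : ℕ) where
  box : ℕ → WithTop (Fin M)
  finite_balls : {p | box p ≠ ⊤}.Finite

/-- The configuration that begins with the given word and is empty afterwards. -/
def Config.ofWord {M : ℕ} (w : List (WithTop (Fin M))) : Config M where
  box p := w.getD p ⊤
  finite_balls := by
    refine (Set.finite_lt_nat w.length).subset fun p hp => ?_
    by_contra h
    exact hp (List.getD_eq_default w ⊤ (not_lt.mp h))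

namespace Config

variable {M : ℕ}

/-- The ball word `f(u)`: the letters of `u` from left to right, with all empty boxes removed. -/
noncomputable def ballWord (u : Config M) : List (Fin M) :=
  (u.finite_balls.toFinset.sort (· ≤ ·)).filterMap u.box

/-- A block of balls is a maximal run of consecutive boxes which all contain balls and whose colours
are non-decreasing. Box `p` is the first box of a block iff it contains a ball, and either `p = 0`
or `u_{p-1} > u_p` (that is, box `p - 1` is empty or contains a ball of larger colour). -/
def IsBlockStart (u : Config M) (p : ℕ) : Prop :=
  u.box p ≠ ⊤ ∧ ∀ r, r + 1 = p → u.box p < u.box r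

/-- The number of blocks of `u`. -/
noncomputable def blockCount (u : Config M) : ℕ :=
  {p | u.IsBlockStart p}.ncard

/-- The number of blocks that begin in one of the boxes `0, …, p`. A ball in box `p` belongs to the
`(i+1)`-st block iff this number is `i + 1`; an empty box `p` lies immediately in front of the
`(i+1)`-st block (in the gap between the `i`-th and the `(i+1)`-st block, or for `i = 0` left of
all blocks) iff this number is `i` and there are more than `i` blocks. -/
noncomputable def blockIndex (u : Config M) (p : ℕ) : ℕ :=
  {r | r ≤ p ∧ u.IsBlockStart r}.ncard

end Config

/-! ### Block coordinates -/

/-- Block coordinates: `num` blocks of balls, numbered `0, …, num - 1`. `Q i j` is the number of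
balls of colour `j` in block `i`, and `gap i` is the number of empty boxes immediately in front of
block `i`; so `gap 0` is `E_{-1}`, and `gap (i + 1)` is `E_i`.
Only the values at indices `i < num` are meaningful. -/
structure Blocks (M : ℕ) where
  num : ℕ
  Q : ℕ → Fin M → ℕ
  gap : ℕ → ℕ

/-- The block coordinates of a configuration. -/
noncomputable def Config.toBlocks {M : ℕ} (u : Config M) : Blocks M where
  num := u.blockCount
  Q i j := {p | u.box p = (j : WithTop (Fin M)) ∧ u.blockIndex p = i + 1}.ncard
  gap i := {p | u.box p = ⊤ ∧ u.blockIndex p = i}.ncard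

/-- The configuration with given block coordinates: for `i = 0, 1, …`, `gap i` empty boxes followed
by the balls of block `i` in increasing order of their colours. -/
def Blocks.toConfig {M : ℕ} (s : Blocks M) : Config M :=
  Config.ofWord <| (List.range s.num).flatMap fun i =>
    List.replicate (s.gap i) ⊤ ++
      (List.finRange M).flatMap fun j => List.replicate (s.Q i j) (j : WithTop (Fin M))

/-! ### The `ε`-BBS for one colour

In this section `n` is the number of blocks, `Q i` the number of balls (of the colour in question)
in block `i`, and `gap (i + 1)` is `E_i`, `gap 0` is `E_{-1}`. A new value is written with a prime.
The formulas are those of the ultradiscrete elementary Toda orbits. All subtractions are exact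
on the relevant indices (no truncation occurs), since `Q'_i ≤ D_i` and `Q'_i ≤ E_i` if `ε_i = 0`,
and `D_i ≤ Q_i`, `min (Q'_i, E'_{i-1}) = D_i ≤ E_i` if `ε_i = 1`. -/

/-- `min (x, E_i)`, where `E_{n-1} = +∞`. -/
def minGap (n : ℕ) (gap : ℕ → ℕ) (i x : ℕ) : ℕ :=
  if i + 1 < n then min x (gap (i + 1)) else x

/-- The pair `(D_i, Q'_i)`, by recursion on `i`. At `i = 0` one has
`Q_{-1} = D_{-1} = Q'_{-1} = 0`, so that the result does not depend on `ε_{-1}`. -/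
def moveQ (ε : ℕ → Fin 2) (n : ℕ) (Q gap : ℕ → ℕ) : ℕ → ℕ × ℕ
  | 0 =>
    match ε 0 with
    | 0 => (Q 0, minGap n gap 0 (Q 0))
    | 1 => (minGap n gap 0 (Q 0), minGap n gap 0 (Q 0))
  | i + 1 =>
    let D := (moveQ ε n Q gap i).1
    let Q' := (moveQ ε n Q gap i).2
    match ε i, ε (i + 1) with
    | 0, 0 =>
      let d := Q (i + 1) + D - Q'
      (d, minGap n gap (i + 1) d)
    | 1, 1 =>
      let d := minGap n gap (i + 1) (Q (i + 1))
      (d, d + Q i - D)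
    | 0, 1 =>
      let d := minGap n gap (i + 1) (Q (i + 1))
      (d, d + D - Q')
    | 1, 0 =>
      let d := Q (i + 1) + Q i - D
      (d, minGap n gap (i + 1) d)

/-- The new gaps: `E'_{-1} = E_{-1} + min (Q_0, 𝓔_0 + E_0)` and
`E'_i = min (Q_{i+1}, 𝓔_{i+1} + E_{i+1}) - min (Q'_i, 𝓔_i + E'_{i-1}) + E_i`,
where `𝓔_k = +∞` if `ε_k = 0`, and `𝓔_k = 0` if `ε_k = 1`. -/
def moveGap (ε : ℕ → Fin 2) (n : ℕ) (Q gap : ℕ → ℕ) : ℕ → ℕ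
  | 0 => gap 0 + (if ε 0 = 0 then Q 0 else minGap n gap 0 (Q 0))
  | i + 1 =>
    let Q' := (moveQ ε n Q gap i).2
    (if ε (i + 1) = 0 then Q (i + 1) else minGap n gap (i + 1) (Q (i + 1))) + gap (i + 1)
      - (if ε i = 0 then Q' else min Q' (moveGap ε n Q gap i))

/-! ### The hungry `ε`-BBS -/

/-- The `ε`-BBS applied to the balls of colour `j`, as if there were no other balls. -/
def Blocks.moveColor {M : ℕ} (ε : ℕ → Fin 2) (s : Blocks M) (j : Fin M) : Blocks M where
  num := s.num
  Q i := Function.update (s.Q i) j (moveQ ε s.num (fun k => s.Q k j) s.gap i).2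
  gap := moveGap ε s.num (fun k => s.Q k j) s.gap

/-- All colours are moved once, in increasing order. -/
def Blocks.evolve {M : ℕ} (ε : ℕ → Fin 2) (s : Blocks M) : Blocks M :=
  (List.finRange M).foldl (Blocks.moveColor ε) s

/-- `ε ∈ {0,1}^N`, continued by `0`. -/
def extendZero {N : ℕ} (ε : Fin N → Fin 2) (i : ℕ) : Fin 2 :=
  if h : i < N then ε ⟨i, h⟩ else 0

/-- The time evolution `T_ε` of the hungry `ε`-BBS for `ε = (ε_0, …, ε_{N-1}) ∈ {0,1}^N`. The entry
`ε_i` belongs to the `(i+1)`-st block of balls. The main case is that of a configuration with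
exactly `N` blocks; entries without a block are not used, and blocks without an entry
get the entry `0` of the ordinary box-ball system. -/
noncomputable def timeEvolution {M N : ℕ} (ε : Fin N → Fin 2) (u : Config M) : Config M :=
  (u.toBlocks.evolve (extendZero ε)).toConfig

end HungryBBS

/-!
The one-colour step is a sequence of moves between adjacent blocks. If block `i` holds `a` balls of
the colour in question, block `i + 1` holds `b`, and `E` empty boxes separate them, then the move
between them leaves `min a E` balls in block `i`, sends the others to block `i + 1`, and changes the
gap to `E - min a E + b`. The entry `ε i` only decides in which order the move from block `i - 1` to
block `i` and the move from block `i` to block `i + 1` are performed. This is how the formulas for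
`D_i`, `Q'_i`, `E'_i` are read in `tgtAfter_succ`, `srcAfter_eq` and `moveGap_succ`.

For a fixed pair of adjacent blocks, take the moves of all colours `1, …, M` together, with the gap
`E` before colour `1`. Let `A` and `B` be the non-decreasing words of the two blocks. Keep the first
`E` letters of `A` and insert `B` into the row formed by the other letters of `A`. The letters kept,
followed by the letters thrown out, form the new first block, and the resulting row is the new second
block. Since row insertion is a composition of Knuth moves, the two blocks before and after are
plactically equivalent (`placticEquiv_rowWord_append`). Following the moves along the chain of
blocks gives the plactic equivalence of the ball words before and after the time evolution
(`Blocks.placticEquiv_prefix`, `Blocks.placticEquiv_word_evolve`).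

Words related by Knuth moves have the same `P`-symbol. This is proved row by row: a Knuth move acts
trivially on each row, and turns the word thrown out of the row into itself or into a word related to
it by a Knuth move (`KnuthMove.insertRowWord`).
-/

namespace HungryBBS

/-! ### Plactic equivalence -/

section Plactic

variable {α : Type*} [LinearOrder α]

/-- Insertion of a word into a single row: the resulting row, and the word of the letters thrown
out of it. -/
def insertRowWord : List α → List α → List α × List α
  | r, [] => (r, [])
  | r, x :: w =>
    ((insertRowWord (insertRow x r).1 w).1,
      (insertRow x r).2.toList ++ (insertRowWord (insertRow x r).1 w).2)

theorem insertWord_cons (r : List α) (T : List (List α)) (w : List α) :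
    insertWord (r :: T) w = (insertRowWord r w).1 :: insertWord T (insertRowWord r w).2 := by
  induction w generalizing r T with
  | nil => rfl
  | cons x w ih =>
    have h : insertWord (r :: T) (x :: w) = insertWord (insertLetter (r :: T) x) w := rfl
    rw [h, insertLetter, insertRowWord]
    rcases hr : insertRow x r with ⟨r', _ | y⟩
    · simp [ih]
    · simp only [ih, Option.toList_some, List.singleton_append]
      rfl

theorem insertWord_append (T : List (List α)) (v w : List α) :
    insertWord T (v ++ w) = insertWord (insertWord T v) w :=
  List.foldl_append

theorem mem_insertRow_fst {x z : α} {r : List α} (h : z ∈ (insertRow x r).1) : z = x ∨ z ∈ r := by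
  induction r with
  | nil => simpa [insertRow] using h
  | cons y r ih =>
    rw [insertRow] at h
    split_ifs at h <;> simp only [List.mem_cons] at h ⊢ <;> tauto

theorem mem_of_mem_insertRow_snd {x z : α} {r : List α} (h : (insertRow x r).2 = some z) :
    z ∈ r ∧ x < z := by
  induction r with
  | nil => simp [insertRow] at h
  | cons y r ih =>
    rw [insertRow] at h
    split_ifs at h with hxy
    · obtain rfl : y = z := by simpa using h
      exact ⟨by simp, hxy⟩
    · exact ⟨List.mem_cons_of_mem _ (ih h).1, (ih h).2⟩

theorem pairwise_insertRow {x : α} {r : List α} (hr : r.Pairwise (· ≤ ·)) :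
    (insertRow x r).1.Pairwise (· ≤ ·) := by
  induction r with
  | nil => simp [insertRow]
  | cons y r ih =>
    rw [List.pairwise_cons] at hr
    rw [insertRow]
    split_ifs with hxy
    · exact List.pairwise_cons.2 ⟨fun z hz => hxy.le.trans (hr.1 z hz), hr.2⟩
    · refine List.pairwise_cons.2 ⟨fun z hz => ?_, ih hr.2⟩
      rcases mem_insertRow_fst hz with rfl | hz
      · exact not_lt.1 hxy
      · exact hr.1 z hz

/-- The rows of `T` are non-decreasing. This part of semistandardness is all that the invariance of
insertion under Knuth moves requires. -/
def RowsSorted (T : List (List α)) : Prop :=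
  ∀ r ∈ T, r.Pairwise (· ≤ ·)

theorem RowsSorted.insertLetter {T : List (List α)} (hT : RowsSorted T) (x : α) :
    RowsSorted (insertLetter T x) := by
  induction T generalizing x with
  | nil => simp [RowsSorted, HungryBBS.insertLetter]
  | cons r T ih =>
    have hr := pairwise_insertRow (x := x) (hT r (by simp))
    have hT' : RowsSorted T := fun s hs => hT s (by simp [hs])
    rw [HungryBBS.insertLetter]
    rcases h : insertRow x r with ⟨r', _ | y⟩ <;> rw [h] at hr
    · exact List.forall_mem_cons.2 ⟨hr, hT'⟩
    · exact List.forall_mem_cons.2 ⟨hr, ih hT' y⟩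

theorem RowsSorted.insertWord {T : List (List α)} (hT : RowsSorted T) (w : List α) :
    RowsSorted (insertWord T w) := by
  induction w generalizing T with
  | nil => exact hT
  | cons x w ih => exact ih (hT.insertLetter x)

/-- The two elementary Knuth moves on words of three letters. -/
inductive KnuthMove : List α → List α → Prop
  | swapLeft {x y z : α} : x ≤ y → y < z → KnuthMove [x, z, y] [z, x, y]
  | swapRight {x y z : α} : x < y → y ≤ z → KnuthMove [y, z, x] [y, x, z]

theorem insertRow_cons_of_lt {x y : α} (h : x < y) (r : List α) :
    insertRow x (y :: r) = (x :: r, some y) := by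
  rw [insertRow, if_pos h]

theorem insertRow_cons_of_le {x y : α} (h : y ≤ x) (r : List α) :
    insertRow x (y :: r) = (y :: (insertRow x r).1, (insertRow x r).2) := by
  rw [insertRow, if_neg h.not_gt]

theorem insertRowWord_cons_of_le {y : α} {w : List α} (h : ∀ x ∈ w, y ≤ x) (r : List α) :
    insertRowWord (y :: r) w = (y :: (insertRowWord r w).1, (insertRowWord r w).2) := by
  induction w generalizing r with
  | nil => rfl
  | cons x w ih =>
    rw [List.forall_mem_cons] at h
    simp only [insertRowWord, insertRow_cons_of_le h.1, ih h.2]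

/-- If `y < z`, then the letter thrown out by `y` after the insertion of `z` is at most `z`. -/
theorem insertRow_snd_after_larger {y z : α} (hyz : y < z) (r : List α) :
    ∃ b ≤ z, (insertRow y (insertRow z r).1).2 = some b := by
  induction r with
  | nil => exact ⟨z, le_rfl, by simp [insertRow, hyz]⟩
  | cons c r ih =>
    rcases lt_or_ge z c with hzc | hzc
    · exact ⟨z, le_rfl, by rw [insertRow_cons_of_lt hzc, insertRow_cons_of_lt hyz]⟩
    · rw [insertRow_cons_of_le hzc]
      rcases lt_or_ge y c with hyc | hyc
      · exact ⟨c, hzc, by rw [insertRow_cons_of_lt hyc]⟩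
      · rwa [insertRow_cons_of_le hyc]

/-- If `y ≤ z`, then the letter thrown out by `z` after the insertion of `y` is at least the letter
thrown out by `y`. -/
theorem insertRow_snd_after_smaller {y z b : α} (hyz : y ≤ z) {r : List α}
    (hr : r.Pairwise (· ≤ ·)) (hb : (insertRow z (insertRow y r).1).2 = some b) :
    ∃ c ≤ b, (insertRow y r).2 = some c := by
  induction r with
  | nil => simp [insertRow, hyz.not_gt] at hb
  | cons d r ih =>
    rw [List.pairwise_cons] at hr
    rcases lt_or_ge y d with hyd | hyd
    · rw [insertRow_cons_of_lt hyd] at hb ⊢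
      rw [insertRow_cons_of_le hyz] at hb
      exact ⟨d, hr.1 b (mem_of_mem_insertRow_snd hb).1, rfl⟩
    · rw [insertRow_cons_of_le hyd] at hb ⊢
      rw [insertRow_cons_of_le (hyd.trans hyz)] at hb
      exact ih hr.2 hb

/-- Words related by a Knuth move act in the same way on a row, and the words thrown out of it are
equal or again related by a Knuth move. -/
theorem KnuthMove.insertRowWord {w w' : List α} (h : KnuthMove w w') {r : List α}
    (hr : r.Pairwise (· ≤ ·)) :
    (insertRowWord r w).1 = (insertRowWord r w').1 ∧
      ((insertRowWord r w).2 = (insertRowWord r w').2 ∨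
        KnuthMove (insertRowWord r w).2 (insertRowWord r w').2) := by
  induction r with
  | nil =>
    cases h with
    | swapLeft hxy hyz =>
      have hxz := hxy.trans_lt hyz
      simp [HungryBBS.insertRowWord, insertRow, hxy.not_gt, hyz, hxz, hxz.le.not_gt]
    | swapRight hxy hyz =>
      have hxz := hxy.trans_le hyz
      simp [HungryBBS.insertRowWord, insertRow, hyz.not_gt, hxy, hxz.le.not_gt]
  | cons c r ih =>
    by_cases hc : ∀ x ∈ w, c ≤ x
    · have hc' : ∀ x ∈ w', c ≤ x := by cases h <;> simp at hc ⊢ <;> tauto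
      rw [insertRowWord_cons_of_le hc, insertRowWord_cons_of_le hc']
      obtain ⟨h1, h2⟩ := ih (List.pairwise_cons.1 hr).2
      exact ⟨congrArg (c :: ·) h1, h2⟩
    rw [List.pairwise_cons] at hr
    cases h with
    | @swapLeft x y z hxy hyz =>
      have hxz := hxy.trans_lt hyz
      have hxc : x < c := by
        by_contra! hcx
        exact hc (by simp [hcx, hcx.trans hxy, hcx.trans hxz.le])
      rcases lt_or_ge z c with hzc | hcz
      · -- both `z` and `x` are inserted in front, and throw out `c` and `z`
        cases r with
        | nil =>
          simp [HungryBBS.insertRowWord, insertRow, hxc, hzc, hxz.le.not_gt, hyz, hxz,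
            hxy.not_gt]
        | cons d r =>
          have hcd := hr.1 d (by simp)
          have hzd := hzc.trans_le hcd
          simp only [HungryBBS.insertRowWord, insertRow_cons_of_lt, insertRow_cons_of_le, hxc, hzc,
            hxz.le, hxz, hxy, hzd, hyz, hyz.trans hzd, Option.toList_some, List.singleton_append,
            true_and, List.append_nil]
          exact Or.inr (.swapRight hzc hcd)
      · simp only [HungryBBS.insertRowWord, insertRow_cons_of_lt, insertRow_cons_of_le, hxc, hcz,
          hxz.le, hxy, true_and, Option.toList_some, List.singleton_append, List.append_nil]
        obtain ⟨b, hbz, hb⟩ := insertRow_snd_after_larger hyz r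
        rcases hz : (insertRow z r).2 with _ | d
        · simp
        · have hzd := (mem_of_mem_insertRow_snd hz).2
          have hcb : c ≤ b := by
            rcases mem_insertRow_fst (mem_of_mem_insertRow_snd hb).1 with rfl | hb
            · exact hcz
            · exact hr.1 b hb
          rw [hb]
          exact Or.inr (.swapLeft hcb (hbz.trans_lt hzd))
    | @swapRight x y z hxy hyz =>
      have hxz := hxy.trans_le hyz
      have hxc : x < c := by
        by_contra! hcx
        exact hc (by simp [hcx, hcx.trans hxy.le, hcx.trans hxz.le])
      rcases lt_or_ge y c with hyc | hcy
      · simp only [HungryBBS.insertRowWord, insertRow_cons_of_lt, insertRow_cons_of_le, hyc, hxy,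
          hyz, hxz.le, true_and, Option.toList_some, List.singleton_append, List.append_nil]
        rcases hz : (insertRow z r).2 with _ | d
        · simp
        · exact Or.inr (.swapRight hyc (hr.1 d (mem_of_mem_insertRow_snd hz).1))
      · simp only [HungryBBS.insertRowWord, insertRow_cons_of_lt, insertRow_cons_of_le, hcy, hxc,
          hcy.trans hyz, hxz.le, true_and, Option.toList_some, List.append_nil]
        rcases hz : (insertRow z (insertRow y r).1).2 with _ | d
        · simp
        · obtain ⟨b, hbd, hb⟩ := insertRow_snd_after_smaller hyz hr.2 hz
          rw [hb]
          exact Or.inr (.swapRight (hcy.trans_lt (mem_of_mem_insertRow_snd hb).2) hbd)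

/-- Plactic equivalence, in the form needed here: the words have the same effect when they are
inserted into any tableau with non-decreasing rows. -/
def PlacticEquiv (w w' : List α) : Prop :=
  ∀ T : List (List α), RowsSorted T → insertWord T w = insertWord T w'

theorem KnuthMove.placticEquiv {w w' : List α} (h : KnuthMove w w') : PlacticEquiv w w' := by
  intro T
  induction T generalizing w w' with
  | nil =>
    intro _
    cases h with
    | swapLeft hxy hyz =>
      have hxz := hxy.trans_lt hyz
      simp [insertWord, insertLetter, insertRow, hxy.not_gt, hyz, hxz, hxz.le.not_gt]
    | swapRight hxy hyz =>
      have hxz := hxy.trans_le hyz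
      simp [insertWord, insertLetter, insertRow, hyz.not_gt, hxy, hxz.le.not_gt]
  | cons r T ih =>
    intro hT
    obtain ⟨hrow, hbump⟩ := h.insertRowWord (hT r (by simp))
    rw [insertWord_cons, insertWord_cons, hrow]
    rcases hbump with hbump | hbump
    · rw [hbump]
    · rw [ih hbump fun s hs => hT s (by simp [hs])]

namespace PlacticEquiv

theorem refl (w : List α) : PlacticEquiv w w := fun _ _ => rfl

theorem trans {u v w : List α} (h : PlacticEquiv u v) (h' : PlacticEquiv v w) :
    PlacticEquiv u w := fun T hT => (h T hT).trans (h' T hT)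

theorem append_right {v w : List α} (h : PlacticEquiv v w) (u : List α) :
    PlacticEquiv (v ++ u) (w ++ u) := fun T hT => by
  rw [insertWord_append, insertWord_append, h T hT]

theorem append_left {v w : List α} (h : PlacticEquiv v w) (u : List α) :
    PlacticEquiv (u ++ v) (u ++ w) := fun T hT => by
  rw [insertWord_append, insertWord_append, h _ (hT.insertWord u)]

theorem pSymbol_eq {v w : List α} (h : PlacticEquiv v w) : pSymbol v = pSymbol w :=
  h [] (by simp [RowsSorted])

end PlacticEquiv

/-! ### Two adjacent blocks -/

/-- A letter `x` at the right end of a row `s :: S` of larger letters moves to the left until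
it stands behind `s`. -/
theorem placticEquiv_moveLeft {x s : α} {S : List α} (hx : x < s)
    (hS : (s :: S).Pairwise (· ≤ ·)) : PlacticEquiv (s :: S ++ [x]) (s :: x :: S) := by
  induction S generalizing s with
  | nil => exact .refl _
  | cons t S ih =>
    rw [List.pairwise_cons] at hS
    have hst := hS.1 t (by simp)
    have h1 : PlacticEquiv (s :: t :: S ++ [x]) (s :: t :: x :: S) :=
      (ih (hx.trans_le hst) hS.2).append_left [s]
    exact h1.trans ((KnuthMove.swapRight hx hst).placticEquiv.append_right S)

/-- A large letter `s` standing in front of the last letter of a row `P ++ [x]` of smaller letters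
moves to the left end. -/
theorem placticEquiv_moveFront {x s : α} {P : List α} (hx : x < s)
    (hP : (P ++ [x]).Pairwise (· ≤ ·)) : PlacticEquiv (P ++ [s, x]) (s :: P ++ [x]) := by
  induction P using List.reverseRecOn generalizing x with
  | nil => exact .refl _
  | append_singleton P p ih =>
    rw [List.pairwise_append] at hP
    have hpx : p ≤ x := hP.2.2 p (by simp) x (by simp)
    have h1 : PlacticEquiv (P ++ [p] ++ [s, x]) (P ++ [s, p] ++ [x]) := by
      simpa using (KnuthMove.swapLeft hpx hx).placticEquiv.append_left P
    refine h1.trans ?_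
    simpa using (ih (hpx.trans_lt hx) hP.1).append_right [x]

/-- Insertion of `m` equal letters `x` into a row `P ++ S` with `P ≤ x < S`: the first `m` letters
of `S` are thrown out (all letters of `S`, if there are fewer). -/
theorem placticEquiv_insert_replicate {x : α} {P S : List α}
    (hP : P.Pairwise (· ≤ ·)) (hPx : ∀ p ∈ P, p ≤ x) (hS : S.Pairwise (· ≤ ·))
    (hxS : ∀ s ∈ S, x < s) (m : ℕ) :
    PlacticEquiv (P ++ S ++ List.replicate m x)
      (S.take m ++ (P ++ List.replicate m x ++ S.drop m)) := by
  induction m generalizing P S with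
  | zero => simpa using PlacticEquiv.refl _
  | succ m ih =>
    cases S with
    | nil => simpa using PlacticEquiv.refl _
    | cons s S =>
      have hPx' : (P ++ [x]).Pairwise (· ≤ ·) :=
        List.pairwise_append.2 ⟨hP, by simp, by simpa using hPx⟩
      have hx : x < s := hxS s (by simp)
      have h1 : PlacticEquiv (P ++ (s :: S) ++ [x]) (s :: (P ++ [x] ++ S)) := by
        have h2 := (placticEquiv_moveLeft hx hS).append_left P
        have h3 := (placticEquiv_moveFront hx hPx').append_right S
        simp only [List.append_assoc, List.cons_append, List.nil_append] at h2 h3 ⊢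
        exact h2.trans h3
      have h4 := (ih hPx' (by simpa [or_imp, forall_and] using hPx) (List.pairwise_cons.1 hS).2
        fun t ht => hxS t (by simp [ht])).append_left [s]
      have h5 := h1.append_right (List.replicate m x)
      simp only [List.append_assoc, List.cons_append, List.nil_append, List.replicate_succ,
        List.take_succ_cons, List.drop_succ_cons] at h4 h5 ⊢
      exact h5.trans h4

/-- The non-decreasing word with `a j` letters `j` for the letters `j` in the increasing list `l`. -/
def rowWord (l : List α) (a : α → ℕ) : List α :=
  l.flatMap fun j => List.replicate (a j) j

theorem mem_of_mem_rowWord {β : Type*} {l : List β} {a : β → ℕ} {j : β}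
    (h : j ∈ rowWord l a) : j ∈ l := by
  simp only [rowWord, List.mem_flatMap, List.mem_replicate] at h
  obtain ⟨k, hk, -, rfl⟩ := h
  exact hk

theorem pairwise_rowWord {l : List α} (hl : l.Pairwise (· < ·)) (a : α → ℕ) :
    (rowWord l a).Pairwise (· ≤ ·) := by
  induction l with
  | nil => simp [rowWord]
  | cons j l ih =>
    rw [List.pairwise_cons] at hl
    rw [rowWord, List.flatMap_cons]
    refine List.pairwise_append.2 ⟨by simp [List.pairwise_replicate], ih hl.2, fun x hx y hy => ?_⟩
    obtain rfl := (List.mem_replicate.1 hx).2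
    exact (hl.1 y (mem_of_mem_rowWord hy)).le

/-- The step of the induction for `placticEquiv_rowWord_append`, when the letters of `l` are still to
be treated: `V` is the part of the new first block, and `P` the part of the current row, that
consists of the letters already treated. Of the letters of `l` in the old first block, the first
`E 0` have been kept or thrown out, the others are still in the row. -/
theorem placticEquiv_rowWord_aux {l : List α} (hl : l.Pairwise (· < ·)) {a b a' b' : α → ℕ}
    {E : ℕ → ℕ} (ha : ∀ k (hk : k < l.length), a' l[k] = min (a l[k]) (E k))
    (hb : ∀ k (hk : k < l.length), b' l[k] + a' l[k] = b l[k] + a l[k])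
    (hE : ∀ k (hk : k < l.length), E (k + 1) + a' l[k] = b l[k] + E k)
    {V P : List α} (hP : P.Pairwise (· ≤ ·)) (hPl : ∀ p ∈ P, ∀ j ∈ l, p ≤ j) :
    PlacticEquiv (V ++ (rowWord l a).take (E 0) ++ (P ++ (rowWord l a).drop (E 0)) ++ rowWord l b)
      (V ++ rowWord l a' ++ (P ++ rowWord l b')) := by
  induction l generalizing V P E with
  | nil => simpa [rowWord] using PlacticEquiv.refl _
  | cons j l ih =>
    have ha0 : a' j = min (a j) (E 0) := ha 0 (by simp)
    have hb0 : b' j + a' j = b j + a j := hb 0 (by simp)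
    have hE0 : E 1 + a' j = b j + E 0 := hE 0 (by simp)
    rw [List.pairwise_cons] at hl
    have hPj : ∀ p ∈ P, p ≤ j := fun p hp => hPl p hp j (by simp)
    have hPr : ∀ m, (P ++ List.replicate m j).Pairwise (· ≤ ·) := fun m =>
      List.pairwise_append.2 ⟨hP, by simp [List.pairwise_replicate], fun p hp q hq => by
        rw [(List.mem_replicate.1 hq).2]; exact hPj p hp⟩
    have hPrj : ∀ m, ∀ p ∈ P ++ List.replicate m j, p ≤ j := fun m p hp => by
      rcases List.mem_append.1 hp with hp | hp
      · exact hPj p hp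
      · exact (List.mem_replicate.1 hp).2.le
    have hcons : ∀ c : α → ℕ, rowWord (j :: l) c = List.replicate (c j) j ++ rowWord l c :=
      fun c => List.flatMap_cons
    have hrow := pairwise_rowWord hl.2 a
    have hins := placticEquiv_insert_replicate (hPr (a j - a' j)) (hPrj _)
      (hrow.drop (i := E 0 - a j))
      (fun s hs => hl.1 s (mem_of_mem_rowWord (List.mem_of_mem_drop hs))) (b j)
    have hrest := ih hl.2 (E := fun k => E (k + 1)) (fun k hk => ha (k + 1) (by simpa using hk))
      (fun k hk => hb (k + 1) (by simpa using hk)) (fun k hk => hE (k + 1) (by simpa using hk))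
      (V := V ++ List.replicate (a' j) j) (hPr (b' j))
      (fun p hp i hi => (hPrj _ p hp).trans (hl.1 i hi).le)
    have e1 : min (E 0) (a j) = a' j := by omega
    have e2 : a j - E 0 = a j - a' j := by omega
    have e3 : a j - a' j + b j = b' j := by omega
    have e4 : E 1 = E 0 - a j + b j := by omega
    have hins' := (hins.append_left
      (V ++ List.replicate (a' j) j ++ (rowWord l a).take (E 0 - a j))).append_right (rowWord l b)
    rw [List.append_assoc P (List.replicate _ j) (List.replicate _ j),
      List.replicate_append_replicate, e3, List.drop_drop] at hins'
    simp only [zero_add, e4, List.take_add] at hrest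
    simp only [hcons, List.take_append, List.drop_append, List.take_replicate, List.drop_replicate,
      List.length_replicate, e1, e2]
    simp only [List.append_assoc] at hins' hrest ⊢
    exact hins'.trans hrest

/-- The move of balls between two adjacent blocks that are separated by `E 0` empty boxes does not
change the plactic class. With `l = [j₀, j₁, …]`, the number `E k` is the size of the gap when it is
the turn of the colour `j_k`. The new first block is obtained by keeping the first `E 0` balls of
the old one, and adding those thrown out of the remaining row by the insertion of the second
block. -/
theorem placticEquiv_rowWord_append {l : List α} (hl : l.Pairwise (· < ·)) {a b a' b' : α → ℕ}
    {E : ℕ → ℕ} (ha : ∀ k (hk : k < l.length), a' l[k] = min (a l[k]) (E k))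
    (hb : ∀ k (hk : k < l.length), b' l[k] + a' l[k] = b l[k] + a l[k])
    (hE : ∀ k (hk : k < l.length), E (k + 1) + a' l[k] = b l[k] + E k) :
    PlacticEquiv (rowWord l a ++ rowWord l b) (rowWord l a' ++ rowWord l b') := by
  simpa using placticEquiv_rowWord_aux hl ha hb hE (V := []) (P := []) .nil (by simp)

end Plactic

/-! ### The one-colour step as a sequence of moves between adjacent blocks -/

section Step

variable (ε : ℕ → Fin 2) (n : ℕ) (Q gap : ℕ → ℕ)

/-- The number of balls in block `i` immediately before balls are moved from block `i` to block
`i + 1`. For `ε i = 0` the balls coming from block `i - 1` have already arrived, for `ε i = 1` they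
have not. -/
def srcBefore (i : ℕ) : ℕ := if ε i = 0 then (moveQ ε n Q gap i).1 else Q i

/-- The number of balls in block `i` immediately after balls are moved from block `i` to block
`i + 1`. -/
def srcAfter (i : ℕ) : ℕ :=
  if ε i = 0 then (moveQ ε n Q gap i).2 else (moveQ ε n Q gap i).1

/-- The number of balls in block `i` immediately before the balls from block `i - 1` arrive. -/
def tgtBefore (i : ℕ) : ℕ := if ε i = 0 then Q i else (moveQ ε n Q gap i).1

/-- The number of balls in block `i` immediately after the balls from block `i - 1` arrive. -/
def tgtAfter (i : ℕ) : ℕ :=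
  if ε i = 0 then (moveQ ε n Q gap i).1 else (moveQ ε n Q gap i).2

theorem eps_cases (i : ℕ) : ε i = 0 ∨ ε i = 1 := by
  generalize ε i = e
  fin_cases e <;> simp

theorem srcAfter_eq (i : ℕ) :
    srcAfter ε n Q gap i = minGap n gap i (srcBefore ε n Q gap i) := by
  rcases i with _ | i
  · rcases eps_cases ε 0 with h | h <;> simp [srcAfter, srcBefore, moveQ, h]
  · rcases eps_cases ε i with h | h <;> rcases eps_cases ε (i + 1) with h' | h' <;>
      simp [srcAfter, srcBefore, moveQ, h, h']

theorem minGap_le (i x : ℕ) : minGap n gap i x ≤ x := by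
  rw [minGap]; split_ifs <;> simp

theorem tgtAfter_zero : tgtAfter ε n Q gap 0 = tgtBefore ε n Q gap 0 := by
  rcases eps_cases ε 0 with h | h <;> simp [tgtAfter, tgtBefore, moveQ, h]

/-- The move from block `i` to block `i + 1` preserves the number of balls. -/
theorem tgtAfter_succ (i : ℕ) :
    tgtAfter ε n Q gap (i + 1) + srcAfter ε n Q gap i =
      tgtBefore ε n Q gap (i + 1) + srcBefore ε n Q gap i := by
  have h1 := srcAfter_eq ε n Q gap i
  have h2 := minGap_le n gap i (srcBefore ε n Q gap i)
  rw [← h1] at h2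
  rcases eps_cases ε i with h | h <;> rcases eps_cases ε (i + 1) with h' | h' <;>
    simp [srcAfter, srcBefore, tgtAfter, tgtBefore, moveQ, h, h'] at h2 ⊢ <;> omega

theorem moveGap_succ_of_subtrahend {i : ℕ} (hi : i + 1 < n)
    (h : (if ε i = 0 then (moveQ ε n Q gap i).2
      else min (moveQ ε n Q gap i).2 (moveGap ε n Q gap i)) = srcAfter ε n Q gap i) :
    moveGap ε n Q gap (i + 1) + srcAfter ε n Q gap i =
      tgtBefore ε n Q gap (i + 1) + gap (i + 1) := by
  have h1 := srcAfter_eq ε n Q gap i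
  rw [minGap, if_pos hi] at h1
  have h2 : (if ε (i + 1) = 0 then Q (i + 1) else minGap n gap (i + 1) (Q (i + 1))) =
      tgtBefore ε n Q gap (i + 1) := by
    rcases eps_cases ε i with h | h <;> rcases eps_cases ε (i + 1) with h' | h' <;>
      simp [tgtBefore, moveQ, h, h']
  rw [moveGap, h, h2]
  omega

/-- The number subtracted in the formula for the new gap `E'_i` is the number of balls left in block
`i` by the move from block `i` to block `i + 1`. -/
theorem moveGap_subtrahend {i : ℕ} (hi : i < n) :
    (if ε i = 0 then (moveQ ε n Q gap i).2
      else min (moveQ ε n Q gap i).2 (moveGap ε n Q gap i)) = srcAfter ε n Q gap i := by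
  induction i with
  | zero => rcases eps_cases ε 0 with h | h <;> simp [srcAfter, moveQ, moveGap, h]
  | succ i ih =>
    have hgap := moveGap_succ_of_subtrahend ε n Q gap hi (ih (by omega))
    have htgt := tgtAfter_succ ε n Q gap i
    have hsrc := srcAfter_eq ε n Q gap i
    rw [minGap, if_pos hi] at hsrc
    rcases eps_cases ε (i + 1) with h | h
    · simp [srcAfter, h]
    · -- with `a` balls in block `i` and gap `E` before the move from block `i`, and `D` balls in
      -- block `i + 1`, both terms of the minimum exceed `D - min a E`, by `a` and by `E`
      simp only [srcAfter, tgtBefore, tgtAfter, h, Fin.isValue, one_ne_zero, if_false]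
        at hgap htgt hsrc ⊢
      omega

/-- The new gap between blocks `i` and `i + 1` is the old one, increased by the balls of block
`i + 1` and diminished by those that remain in block `i`. -/
theorem moveGap_succ {i : ℕ} (hi : i + 1 < n) :
    moveGap ε n Q gap (i + 1) + srcAfter ε n Q gap i =
      tgtBefore ε n Q gap (i + 1) + gap (i + 1) :=
  moveGap_succ_of_subtrahend ε n Q gap hi (moveGap_subtrahend ε n Q gap (by omega))

end Step

/-! ### All colours -/

namespace Blocks

variable {M : ℕ} (ε : ℕ → Fin 2) (s : Blocks M)

/-- The gaps after the colours `0, …, k - 1` have been moved. -/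
def gapAt : ℕ → ℕ → ℕ
  | 0 => s.gap
  | k + 1 =>
    if h : k < M then moveGap ε s.num (fun i => s.Q i ⟨k, h⟩) (gapAt k) else gapAt k

theorem foldl_moveColor_take (k : ℕ) (hk : k ≤ M) :
    ((List.finRange M).take k).foldl (moveColor ε) s =
      { num := s.num
        Q := fun i j => if (j : ℕ) < k then
          (moveQ ε s.num (fun i => s.Q i j) (s.gapAt ε j) i).2 else s.Q i j
        gap := s.gapAt ε k } := by
  induction k with
  | zero => simp [gapAt]
  | succ k ih =>
    rw [← List.take_concat_get' _ _ (by simpa using hk), List.foldl_append, ih (by omega)]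
    have hk' : k < M := hk
    simp only [List.getElem_finRange, List.foldl_cons, List.foldl_nil, moveColor, gapAt, hk',
      dif_pos, Fin.cast_mk, lt_irrefl, if_false]
    congr 1
    funext i j
    rcases eq_or_ne j ⟨k, hk'⟩ with rfl | hj
    · simp
    · have : (j : ℕ) ≠ k := fun h => hj (Fin.ext h)
      rw [Function.update_of_ne hj]
      congr 1
      simp only [eq_iff_iff]
      omega

theorem evolve_eq : s.evolve ε =
    { num := s.num
      Q := fun i j => (moveQ ε s.num (fun i => s.Q i j) (s.gapAt ε j) i).2
      gap := s.gapAt ε M } := by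
  have h := s.foldl_moveColor_take ε M le_rfl
  rw [List.take_of_length_le (by simp)] at h
  simpa [evolve] using h

/-- The balls of all blocks, from left to right. -/
def word : List (Fin M) :=
  (List.range s.num).flatMap fun i => rowWord (List.finRange M) (s.Q i)

/-- The blocks `0, …, i - 1`, followed by block `i` as it is before the arrival of balls from block
`i - 1`, are plactically equivalent to the evolved blocks `0, …, i - 1`, followed by block `i` as it
is after this arrival. The two values of `ε i` correspond to the two orders in which the move from
block `i - 1` and the move from block `i` can be performed. -/
theorem placticEquiv_prefix {i : ℕ} (hi : i < s.num) :
    PlacticEquiv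
      (((List.range i).flatMap fun k => rowWord (List.finRange M) (s.Q k)) ++
        rowWord (List.finRange M) fun j =>
          tgtBefore ε s.num (fun k => s.Q k j) (s.gapAt ε j) i)
      (((List.range i).flatMap fun k => rowWord (List.finRange M) ((s.evolve ε).Q k)) ++
        rowWord (List.finRange M) fun j =>
          tgtAfter ε s.num (fun k => s.Q k j) (s.gapAt ε j) i) := by
  induction i with
  | zero => simpa [tgtAfter_zero] using PlacticEquiv.refl _
  | succ i ih =>
    have ih := ih (by omega)
    have hmove : PlacticEquiv _ _ := placticEquiv_rowWord_append (List.pairwise_lt_finRange M)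
      (a := fun j => srcBefore ε s.num (fun k => s.Q k j) (s.gapAt ε j) i)
      (b := fun j => tgtBefore ε s.num (fun k => s.Q k j) (s.gapAt ε j) (i + 1))
      (a' := fun j => srcAfter ε s.num (fun k => s.Q k j) (s.gapAt ε j) i)
      (b' := fun j => tgtAfter ε s.num (fun k => s.Q k j) (s.gapAt ε j) (i + 1))
      (E := fun k => s.gapAt ε k (i + 1))
      (fun k hk => by simp [srcAfter_eq, minGap, hi])
      (fun k hk => tgtAfter_succ ..)
      (fun k hk => by
        have hk' : k < M := by simpa using hk
        simpa [gapAt, hk'] using moveGap_succ ε s.num (fun i => s.Q i ⟨k, hk'⟩) (s.gapAt ε k) hi)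
    simp only [List.range_succ, List.flatMap_append, List.flatMap_singleton]
    rcases eps_cases ε i with h | h
    · simp only [srcBefore, srcAfter, tgtBefore, tgtAfter, h, if_true, evolve_eq] at ih hmove ⊢
      have h1 := ih.append_right (rowWord (List.finRange M) fun j =>
        tgtBefore ε s.num (fun k => s.Q k j) (s.gapAt ε j) (i + 1))
      have h2 := hmove.append_left ((List.range i).flatMap fun k =>
        rowWord (List.finRange M) ((s.evolve ε).Q k))
      simp only [tgtBefore, evolve_eq, List.append_assoc] at h1 h2 ⊢
      exact h1.trans h2
    · simp only [srcBefore, srcAfter, tgtBefore, tgtAfter, h, Fin.isValue, one_ne_zero, if_false,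
        evolve_eq] at ih hmove ⊢
      have h1 := hmove.append_left ((List.range i).flatMap fun k =>
        rowWord (List.finRange M) (s.Q k))
      have h2 := ih.append_right (rowWord (List.finRange M) fun j =>
        tgtAfter ε s.num (fun k => s.Q k j) (s.gapAt ε j) (i + 1))
      simp only [tgtAfter, List.append_assoc] at h1 h2 ⊢
      exact h1.trans h2

theorem placticEquiv_word_evolve : PlacticEquiv s.word (s.evolve ε).word := by
  have hnum : (s.evolve ε).num = s.num := by rw [evolve_eq]
  rw [word, word, hnum]
  rcases hn : s.num with _ | n
  · simpa using PlacticEquiv.refl _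
  · have h := s.placticEquiv_prefix ε (i := n) (by omega)
    -- the gap behind the last block is infinite, so no ball leaves the last block
    have hlast : ∀ Q gap : ℕ → ℕ, srcAfter ε s.num Q gap n = srcBefore ε s.num Q gap n := by
      intro Q gap
      simp [srcAfter_eq, minGap, hn]
    simp only [List.range_succ, List.flatMap_append, List.flatMap_singleton]
    rcases eps_cases ε n with h' | h' <;>
    · simp only [srcBefore, srcAfter, h', tgtBefore, tgtAfter, Fin.isValue, one_ne_zero, if_true,
        if_false] at h hlast
      simpa only [evolve_eq, hlast] using h

end Blocks

/-! ### Configurations and their block coordinates -/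

namespace Config

variable {M : ℕ}

/-- The colour of the ball in a box, if there is one. This map is the identity; its name separates
the types `WithTop (Fin M)` and `Option (Fin M)`. -/
def colour (x : WithTop (Fin M)) : Option (Fin M) := x

@[simp] theorem colour_top : colour (⊤ : WithTop (Fin M)) = none := rfl

@[simp] theorem colour_coe (j : Fin M) : colour (j : WithTop (Fin M)) = some j := rfl

theorem colour_eq_some {x : WithTop (Fin M)} {j : Fin M} : colour x = some j ↔ x = j := Iff.rfl

/-- The boxes with balls, from left to right. -/
noncomputable def ballPositions (u : Config M) : List ℕ :=
  u.finite_balls.toFinset.sort (· ≤ ·)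

theorem mem_ballPositions {u : Config M} {p : ℕ} : p ∈ u.ballPositions ↔ u.box p ≠ ⊤ := by
  simp [ballPositions]

theorem nodup_ballPositions (u : Config M) : u.ballPositions.Nodup :=
  Finset.sort_nodup _ _

theorem pairwise_ballPositions (u : Config M) : u.ballPositions.Pairwise (· ≤ ·) :=
  Finset.pairwise_sort _ _

theorem ballWord_eq (u : Config M) :
    u.ballWord = u.ballPositions.filterMap fun p => colour (u.box p) := rfl

theorem ballWord_ofWord (w : List (WithTop (Fin M))) :
    (ofWord w).ballWord = w.filterMap colour := by
  have hbox : ∀ p, (ofWord w).box p = w.getD p ⊤ := fun _ => rfl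
  have hpos : (ofWord w).ballPositions =
      (List.range w.length).filter fun p => decide (w.getD p ⊤ ≠ ⊤) := by
    refine List.Perm.eq_of_pairwise' (r := (· ≤ ·)) (pairwise_ballPositions _)
      (List.pairwise_le_range.filter _) ?_
    refine (List.perm_ext_iff_of_nodup (nodup_ballPositions _)
      (List.nodup_range.filter _)).2 fun p => ?_
    rw [mem_ballPositions, hbox, List.mem_filter, List.mem_range,
      decide_eq_true_eq]
    refine ⟨fun h => ⟨?_, h⟩, fun h => h.2⟩
    by_contra hp
    exact h (List.getD_eq_default w ⊤ (not_lt.1 hp))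
  have hw : w = (List.range w.length).map fun p => w.getD p ⊤ := by
    refine List.ext_getElem (by simp) fun p h1 h2 => ?_
    simp [h1]
  rw [ballWord_eq, hpos, List.filterMap_filter]
  conv_rhs => rw [hw, List.filterMap_map]
  refine List.filterMap_congr fun p _ => ?_
  rw [hbox, Function.comp_apply]
  split_ifs with h
  · rfl
  · have h' : w.getD p ⊤ = ⊤ := by simpa using h
    rw [h', colour_top]

variable (u : Config M)

theorem finite_blockStarts : {p | u.IsBlockStart p}.Finite :=
  u.finite_balls.subset fun _ hp => hp.1

theorem blockIndex_mono : Monotone u.blockIndex := fun _ q hpq =>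
  Set.ncard_le_ncard (fun _ hr => ⟨hr.1.trans hpq, hr.2⟩)
    ((Set.finite_Iic q).subset fun _ hr => hr.1)

theorem blockIndex_le_blockCount (p : ℕ) : u.blockIndex p ≤ u.blockCount :=
  Set.ncard_le_ncard (fun _ hr => hr.2) u.finite_blockStarts

theorem box_le_of_not_isBlockStart {p : ℕ} (hp : u.box (p + 1) ≠ ⊤)
    (h : ¬ u.IsBlockStart (p + 1)) : u.box p ≤ u.box (p + 1) := by
  by_contra! hlt
  refine h ⟨hp, fun r hr => ?_⟩
  obtain rfl : r = p := by omega
  exact hlt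

theorem blockIndex_lt_of_isBlockStart {p q : ℕ} (hpq : p < q) (hq : u.IsBlockStart q) :
    u.blockIndex p < u.blockIndex q := by
  refine Set.ncard_lt_ncard ((Set.ssubset_iff_of_subset ?_).2 ⟨q, ⟨le_rfl, hq⟩, ?_⟩)
    ((Set.finite_Iic q).subset fun _ hr => hr.1)
  · exact fun r hr => ⟨hr.1.trans hpq.le, hr.2⟩
  · exact fun h => absurd h.1 (by simpa using hpq)

theorem blockIndex_pos {p : ℕ} (hp : u.box p ≠ ⊤) : 0 < u.blockIndex p := by
  induction p with
  | zero =>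
    have : u.IsBlockStart 0 := ⟨hp, fun r hr => by omega⟩
    exact (Set.ncard_pos ((Set.finite_Iic 0).subset fun _ hr => hr.1)).2 ⟨0, le_rfl, this⟩
  | succ p ih =>
    by_cases h : u.IsBlockStart (p + 1)
    · exact (Nat.zero_le _).trans_lt (u.blockIndex_lt_of_isBlockStart p.lt_succ_self h)
    · have hle := u.box_le_of_not_isBlockStart hp h
      exact (ih (ne_top_of_le_ne_top hp hle)).trans_le (u.blockIndex_mono p.le_succ)

theorem box_le_of_blockIndex_eq {p q : ℕ} (hpq : p ≤ q) (hq : u.box q ≠ ⊤)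
    (h : u.blockIndex p = u.blockIndex q) : u.box p ≤ u.box q := by
  induction q, hpq using Nat.le_induction with
  | base => exact le_rfl
  | succ q hpq ih =>
    have hstart : ¬ u.IsBlockStart (q + 1) := fun hs =>
      (u.blockIndex_lt_of_isBlockStart (Nat.lt_succ_of_le hpq) hs).ne h
    have hle := u.box_le_of_not_isBlockStart hq hstart
    refine (ih (ne_top_of_le_ne_top hq hle) (le_antisymm (u.blockIndex_mono hpq) ?_)).trans hle
    rw [h]
    exact u.blockIndex_mono q.le_succ

/-- The pairs (block, colour) of all balls, from left to right. The blocks are numbered from `1`. -/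
noncomputable def ballLabels : List (ℕ ×ₗ Fin M) :=
  u.ballPositions.filterMap fun p => (colour (u.box p)).map fun j => toLex (u.blockIndex p, j)

theorem count_ballLabels (m : ℕ) (j : Fin M) : u.ballLabels.count (toLex (m, j)) =
    {p | u.box p = (j : WithTop (Fin M)) ∧ u.blockIndex p = m}.ncard := by
  have hset : {p | u.box p = (j : WithTop (Fin M)) ∧ u.blockIndex p = m} =
      ((u.ballPositions.filter fun p =>
        decide (u.box p = (j : WithTop (Fin M)) ∧ u.blockIndex p = m)).toFinset : Set ℕ) := by
    ext p
    simp only [Set.mem_ofPred_eq, List.coe_toFinset, List.mem_filter, mem_ballPositions,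
      decide_eq_true_eq]
    exact ⟨fun h => ⟨by simp [h.1], h⟩, fun h => h.2⟩
  rw [hset, Set.ncard_coe_finset, List.toFinset_card_of_nodup (u.nodup_ballPositions.filter _),
    ← List.countP_eq_length_filter, List.count_eq_countP, ballLabels, List.countP_filterMap]
  refine List.countP_congr fun p _ => ?_
  rcases hc : colour (u.box p) with _ | k
  · have : u.box p ≠ j := fun h => by simp [h] at hc
    simp [this]
  · have : u.box p = k := colour_eq_some.1 hc
    simp [this, and_comm]

theorem count_flatMap_replicate (c : ℕ → Fin M → ℕ) (n m : ℕ) (j : Fin M) :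
    ((List.range n).flatMap fun i => (List.finRange M).flatMap fun k =>
      List.replicate (c i k) (toLex (i + 1, k))).count (toLex (m, j)) =
      ∑ i ∈ Finset.range n, if i + 1 = m then c i j else 0 := by
  induction n with
  | zero => simp
  | succ n ih =>
    rw [List.range_succ, List.flatMap_append, List.count_append, ih, Finset.sum_range_succ,
      List.flatMap_singleton, List.count_flatMap]
    congr 1
    have h : (List.count (toLex (m, j)) ∘ fun k => List.replicate (c n k) (toLex (n + 1, k))) =
        fun k => if k = j then (if n + 1 = m then c n k else 0) else 0 := by
      funext k
      by_cases hk : k = j <;> by_cases hm : n + 1 = m <;> simp [List.count_replicate, hk, hm]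
    rw [h, ← Fin.sum_univ_def, Finset.sum_ite_eq' Finset.univ j, if_pos (Finset.mem_univ j)]

/-- Both sides list the balls in lexicographic order. -/
theorem ballLabels_eq : u.ballLabels =
    (List.range u.blockCount).flatMap fun i => (List.finRange M).flatMap fun j =>
      List.replicate (u.toBlocks.Q i j) (toLex (i + 1, j)) := by
  refine List.Perm.eq_of_pairwise' (r := (· ≤ ·)) ?_ ?_ ?_
  · refine List.pairwise_filterMap.2 (u.pairwise_ballPositions.imp fun {p q} hpq => ?_)
    intro x hx y hy
    simp only [Option.map_eq_some_iff, colour_eq_some] at hx hy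
    obtain ⟨j, hj, rfl⟩ := hx
    obtain ⟨k, hk, rfl⟩ := hy
    rw [Prod.Lex.toLex_le_toLex]
    refine (u.blockIndex_mono hpq).lt_or_eq.imp id fun h => ⟨h, ?_⟩
    have := u.box_le_of_blockIndex_eq hpq (by simp [hk]) h
    simpa [hj, hk] using this
  · rw [List.pairwise_flatMap]
    refine ⟨fun i _ => List.pairwise_flatMap.2 ⟨fun j _ => by simp [List.pairwise_replicate], ?_⟩,
      List.pairwise_lt_range.imp fun {i k} hik x hx y hy => ?_⟩
    · refine (List.pairwise_lt_finRange M).imp fun {j k} hjk x hx y hy => ?_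
      rw [(List.mem_replicate.1 hx).2, (List.mem_replicate.1 hy).2, Prod.Lex.toLex_le_toLex]
      exact Or.inr ⟨rfl, hjk.le⟩
    · simp only [List.mem_flatMap, List.mem_replicate] at hx hy
      obtain ⟨j, -, -, rfl⟩ := hx
      obtain ⟨l, -, -, rfl⟩ := hy
      rw [Prod.Lex.toLex_le_toLex]
      exact Or.inl (Nat.succ_lt_succ hik)
  · refine List.perm_iff_count.2 fun x => ?_
    obtain ⟨⟨m, j⟩, rfl⟩ := toLex.surjective x
    rw [count_flatMap_replicate, count_ballLabels]
    have hQ : ∀ i, u.toBlocks.Q i j =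
      {p | u.box p = (j : WithTop (Fin M)) ∧ u.blockIndex p = i + 1}.ncard := fun _ => rfl
    by_cases hm : 0 < m ∧ m ≤ u.blockCount
    · obtain ⟨i, rfl⟩ := Nat.exists_eq_add_one.2 hm.1
      simp only [add_left_inj]
      rw [Finset.sum_ite_eq' (Finset.range u.blockCount) i, if_pos (Finset.mem_range.2 hm.2), hQ]
    · rw [Finset.sum_eq_zero fun i hi => if_neg fun h => hm ?_]
      · convert Set.ncard_empty ℕ
        refine Set.eq_empty_of_forall_notMem fun p hp => hm ?_
        rw [← hp.2]
        exact ⟨u.blockIndex_pos (by simp [hp.1]), u.blockIndex_le_blockCount p⟩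
      · have := Finset.mem_range.1 hi
        omega

/-- The ball word is the concatenation of the blocks. -/
theorem ballWord_eq_word : u.ballWord = u.toBlocks.word := by
  have h := congrArg (List.map fun x => (ofLex x).2) u.ballLabels_eq
  simp only [ballLabels, List.map_filterMap, List.map_flatMap, List.map_replicate,
    Option.map_map] at h
  rw [ballWord_eq, Blocks.word]
  refine Eq.trans ?_ h
  refine List.filterMap_congr fun p _ => ?_
  cases hc : colour (u.box p) <;> simp

end Config

theorem Blocks.ballWord_toConfig {M : ℕ} (s : Blocks M) : s.toConfig.ballWord = s.word := by
  rw [toConfig, Config.ballWord_ofWord, word, List.filterMap_flatMap]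
  refine List.flatMap_congr fun i _ => ?_
  rw [List.filterMap_append, List.filterMap_flatMap, rowWord]
  simp [List.filterMap_replicate]

end HungryBBS

/-- The P-symbol of the ball word is conserved by the hungry `ε`-BBS. -/
theorem proposition4p1 (M N : ℕ) (ε : Fin N → Fin 2) (u : HungryBBS.Config M) :
    HungryBBS.pSymbol u.ballWord =
      HungryBBS.pSymbol (HungryBBS.timeEvolution ε u).ballWord := by
  rw [HungryBBS.timeEvolution, HungryBBS.Blocks.ballWord_toConfig, u.ballWord_eq_word]
  exact (u.toBlocks.placticEquiv_word_evolve _).pSymbol_eq
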